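/- Let $P$ be a smooth finite-dimensional manifold (Hausdorff, second countable, without boundary) and let $\pi\in\Gamma(\bigwedge^2 TP)$ be a smooth bivector field on $P$. Let $\pi^\sharp:T^*P\to TP$ be the map given by $\beta(\pi^\sharp(\alpha))=\pi(\alpha,\beta)$. Suppose that the characteristic distribution $\pi^\sharp(T^*P)\subseteq TP$ is - regular, i.e. $\dim \pi^\sharp(T_x^*P)$ is the same for all $x\in P$, and - integrable, i.e. through every point of $P$ there passes an (injectively immersed) submanifold $\mathcal O$ of $P$ with $T_y\mathcal O=\pi^\sharp(T_y^*P)$ for all $y\in\mathcal O$. Then there exists an exact smooth 3-form $\phi=d\Omega$ on $P$ (with $\Omega$ a smooth 2-form on $P$) such that $\pi$ is $\phi$-twisted Poisson; that is, $\phi$ is closed and $$\tfrac12[\pi,\pi]=\pi^\sharp(\phi).$$ Here $[\cdot,\cdot]$ is the Schouten bracket, normalized so that $\tfrac12[\pi,\pi](df,dg,dh)=\{f,\{g,h\}\}+\{g,\{h,f\}\}+\{h,\{f,g\}\}$ with $\{f,g\}=\pi(df,dg)$, and $\pi^\sharp(\phi)(\alpha,\beta,\gamma)=\phi(\pi^\sharp\alpha,\pi^\sharp\beta,\pi^\sharp\gamma)$.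 -/

import Mathlib

open scoped Manifold ContDiff

/-! ### Differential forms on a smooth manifold -/

section Forms

variable {E : Type*} [NormedAddCommGroup E] [NormedSpace ℝ E]
  {P : Type*} [TopologicalSpace P] [ChartedSpace E P]

/-- The expression of a (not necessarily smooth) field `η` of alternating `k`-forms on `P` in the
chart around `x₀`: the pullback of `ω` along the inverse of that chart. -/
noncomputable def formInChart {k : ℕ} (η : ∀ x : P, TangentSpace 𝓘(ℝ, E) x [⋀^Fin k]→L[ℝ] ℝ)
    (x₀ : P) (y : E) : E [⋀^Fin k]→L[ℝ] ℝ :=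
  (η ((extChartAt 𝓘(ℝ, E) x₀).symm y)).compContinuousLinearMap
    (mfderiv 𝓘(ℝ, E) 𝓘(ℝ, E) (extChartAt 𝓘(ℝ, E) x₀).symm y)

variable (E P) in
/-- A smooth differential `k`-form on `P`. -/
structure DiffForm (k : ℕ) where
  toFun : ∀ x : P, TangentSpace 𝓘(ℝ, E) x [⋀^Fin k]→L[ℝ] ℝ
  smooth' : ∀ x₀ : P, ContDiffOn ℝ ∞ (formInChart toFun x₀) (extChartAt 𝓘(ℝ, E) x₀).target

/-- The exterior derivative of a `k`-form, computed at `x` in the chart around `x`. -/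
noncomputable def DiffForm.extDerivAt {k : ℕ} (η : DiffForm E P k) (x : P) :
    TangentSpace 𝓘(ℝ, E) x [⋀^Fin (k + 1)]→L[ℝ] ℝ :=
  (extDeriv (formInChart η.toFun x) (extChartAt 𝓘(ℝ, E) x x)).compContinuousLinearMap
    (mfderiv 𝓘(ℝ, E) 𝓘(ℝ, E) (extChartAt 𝓘(ℝ, E) x) x)

/-- The form `φ` is closed: `dφ = 0`. -/
def DiffForm.IsClosed {k : ℕ} (φ : DiffForm E P k) : Prop :=
  ∀ x, φ.extDerivAt x = 0

/-- The `(k + 1)`-form `φ` is exact: `φ = dΩ` for a smooth `k`-form `Ω` on all of `P`. -/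
def DiffForm.IsExact {k : ℕ} (φ : DiffForm E P (k + 1)) : Prop :=
  ∃ Ω : DiffForm E P k, ∀ x, φ.toFun x = Ω.extDerivAt x

end Forms

/-! ### Linear algebra: elements of `Λ² V` as alternating forms on the dual of `V` -/

section Sharp

variable {V : Type*} [AddCommGroup V] [Module ℝ V] [TopologicalSpace V]

theorem bivector_apply_add_left (p : (V →L[ℝ] ℝ) [⋀^Fin 2]→L[ℝ] ℝ) (α α' β : V →L[ℝ] ℝ) :
    p ![α + α', β] = p ![α, β] + p ![α', β] := by
  have h := p.map_update_add ![0, β] 0 α α'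
  have e (γ : V →L[ℝ] ℝ) : Function.update ![0, β] 0 γ = ![γ, β] := by
    ext i : 1
    fin_cases i <;> rfl
  rwa [e, e, e] at h

theorem bivector_apply_smul_left (p : (V →L[ℝ] ℝ) [⋀^Fin 2]→L[ℝ] ℝ) (c : ℝ) (α β : V →L[ℝ] ℝ) :
    p ![c • α, β] = c • p ![α, β] := by
  have h := p.map_update_smul ![0, β] 0 c α
  have e (γ : V →L[ℝ] ℝ) : Function.update ![0, β] 0 γ = ![γ, β] := by
    ext i : 1
    fin_cases i <;> rfl
  rwa [e, e] at h

theorem bivector_apply_swap (p : (V →L[ℝ] ℝ) [⋀^Fin 2]→L[ℝ] ℝ) (α β : V →L[ℝ] ℝ) :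
    p ![α, β] = - p ![β, α] := by
  have h := p.map_swap ![β, α] (i := 0) (j := 1) (by decide)
  have e : ![β, α] ∘ Equiv.swap (0 : Fin 2) 1 = ![α, β] := by
    ext i : 1
    fin_cases i <;> rfl
  rw [e] at h
  exact h

variable [IsTopologicalAddGroup V] [ContinuousSMul ℝ V] [T2Space V] [FiniteDimensional ℝ V]

/-- The contraction `p♯ : V* → V` of `p ∈ Λ² V`: `p♯ α` is the vector that corresponds, under the
canonical isomorphism `V ≃ V**`, to the functional `β ↦ p(α, β)`, see `apply_bivectorSharp`. -/
noncomputable def bivectorSharp (p : (V →L[ℝ] ℝ) [⋀^Fin 2]→L[ℝ] ℝ) : (V →L[ℝ] ℝ) →L[ℝ] V :=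
  haveI : FiniteDimensional ℝ (V →L[ℝ] ℝ) :=
    LinearEquiv.finiteDimensional (LinearMap.toContinuousLinearMap : (V →ₗ[ℝ] ℝ) ≃ₗ[ℝ] (V →L[ℝ] ℝ))
  LinearMap.toContinuousLinearMap
    { toFun := fun α => (Module.evalEquiv ℝ V).symm
        { toFun := fun β => p ![α, LinearMap.toContinuousLinearMap β]
          map_add' := fun β γ => by
            rw [bivector_apply_swap, map_add, bivector_apply_add_left, bivector_apply_swap p α,
              bivector_apply_swap p α, neg_add]
          map_smul' := fun c β => by
            rw [bivector_apply_swap, map_smul, bivector_apply_smul_left, bivector_apply_swap p α,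
              smul_neg, RingHom.id_apply] }
      map_add' := fun α α' => by
        rw [← map_add]
        congr 1
        ext β
        exact bivector_apply_add_left p α α' _
      map_smul' := fun c α => by
        rw [← map_smul]
        congr 1
        ext β
        exact bivector_apply_smul_left p c α _ }

/-- The defining property `β(p♯ α) = p(α, β)`. -/
theorem apply_bivectorSharp (p : (V →L[ℝ] ℝ) [⋀^Fin 2]→L[ℝ] ℝ) (α β : V →L[ℝ] ℝ) :
    β (bivectorSharp p α) = p ![α, β] := by
  have h := Module.apply_evalEquiv_symm_apply (R := ℝ) (M := V) (β : V →ₗ[ℝ] ℝ)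
  exact h _

end Sharp

/-! ### Bivector fields, the Schouten bracket, twisted Poisson bivectors -/

section Bivector

variable {E : Type*} [NormedAddCommGroup E] [NormedSpace ℝ E]
  {P : Type*} [TopologicalSpace P] [ChartedSpace E P]

/-- The expression in the chart around `x₀` of a (not necessarily smooth) field `π` of elements of
`Λ² TP`: its pushforward along that chart. -/
noncomputable def bivectorInChart
    (π : ∀ x : P, (TangentSpace 𝓘(ℝ, E) x →L[ℝ] ℝ) [⋀^Fin 2]→L[ℝ] ℝ) (x₀ : P) (y : E) :
    (E →L[ℝ] ℝ) [⋀^Fin 2]→L[ℝ] ℝ :=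
  (π ((extChartAt 𝓘(ℝ, E) x₀).symm y)).compContinuousLinearMap
    (ContinuousLinearMap.precomp ℝ (mfderiv 𝓘(ℝ, E) 𝓘(ℝ, E) (extChartAt 𝓘(ℝ, E) x₀)
      ((extChartAt 𝓘(ℝ, E) x₀).symm y)))

variable (E P) in
/-- A smooth bivector field on the (finite-dimensional) manifold `P`: a section `π` of `Λ² TP`,
that is, a smooth field of alternating bilinear forms `π(α, β)` on the cotangent spaces. -/
structure BivectorField where
  toFun : ∀ x : P, (TangentSpace 𝓘(ℝ, E) x →L[ℝ] ℝ) [⋀^Fin 2]→L[ℝ] ℝ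
  smooth' : ∀ x₀ : P, ContDiffOn ℝ ∞ (bivectorInChart toFun x₀) (extChartAt 𝓘(ℝ, E) x₀).target

variable [FiniteDimensional ℝ E]

/-- The map `π♯ : T*P → TP` at `x`, with `β(π♯ α) = π(α, β)`. -/
noncomputable def BivectorField.sharp (π : BivectorField E P) (x : P) :
    (TangentSpace 𝓘(ℝ, E) x →L[ℝ] ℝ) →L[ℝ] TangentSpace 𝓘(ℝ, E) x :=
  haveI : FiniteDimensional ℝ (TangentSpace 𝓘(ℝ, E) x) := inferInstanceAs (FiniteDimensional ℝ E)
  haveI : T2Space (TangentSpace 𝓘(ℝ, E) x) := inferInstanceAs (T2Space E)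
  bivectorSharp (π.toFun x)

/-- The characteristic distribution `π♯(T*P)`. -/
noncomputable def BivectorField.charDistribution (π : BivectorField E P) (x : P) :
    Submodule ℝ (TangentSpace 𝓘(ℝ, E) x) :=
  (π.sharp x : (TangentSpace 𝓘(ℝ, E) x →L[ℝ] ℝ) →ₗ[ℝ] TangentSpace 𝓘(ℝ, E) x).range

/-- The Schouten bracket of two bivector fields on the vector space `E`, as a 3-vector field:
`[p, q](α, β, γ) = ∑ (p(α, d(q(β, γ))) + q(α, d(p(β, γ))))`, the sum being over the cyclic
permutations of the constant `1`-forms `α`, `β`, `γ`. In coordinates,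
`[p, q]^{ijk} = ∑_{cyc(i,j,k)} ∑_l (p^{il} ∂_l q^{jk} + q^{il} ∂_l p^{jk})`. -/
noncomputable def flatSchouten (p q : E → (E →L[ℝ] ℝ) [⋀^Fin 2]→L[ℝ] ℝ) (y : E) :
    (E →L[ℝ] ℝ) [⋀^Fin 3]→L[ℝ] ℝ :=
  .alternatizeUncurryFin (fderiv ℝ q y ∘L bivectorSharp (p y) + fderiv ℝ p y ∘L bivectorSharp (q y))

/-- The Schouten bracket `[π, σ]` of two bivector fields on `P`, a 3-vector field, computed at `x`
in the chart around `x`. The normalization is such that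
`½[π, π](df, dg, dh) = {f, {g, h}} + {g, {h, f}} + {h, {f, g}}` where `{f, g} = π(df, dg)`. -/
noncomputable def BivectorField.schouten (π σ : BivectorField E P) (x : P) :
    (TangentSpace 𝓘(ℝ, E) x →L[ℝ] ℝ) [⋀^Fin 3]→L[ℝ] ℝ :=
  (flatSchouten (bivectorInChart π.toFun x) (bivectorInChart σ.toFun x)
      (extChartAt 𝓘(ℝ, E) x x)).compContinuousLinearMap
    (ContinuousLinearMap.precomp ℝ (mfderiv 𝓘(ℝ, E) 𝓘(ℝ, E) (extChartAt 𝓘(ℝ, E) x).symm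
      (extChartAt 𝓘(ℝ, E) x x)))

/-- The 3-vector field `π♯(φ)`, with `π♯(φ)(α, β, γ) = φ(π♯ α, π♯ β, π♯ γ)`. -/
noncomputable def BivectorField.sharpForm (π : BivectorField E P) (φ : DiffForm E P 3) (x : P) :
    (TangentSpace 𝓘(ℝ, E) x →L[ℝ] ℝ) [⋀^Fin 3]→L[ℝ] ℝ :=
  (φ.toFun x).compContinuousLinearMap (π.sharp x)

/-- `π` is `φ`-twisted Poisson: `φ` is a closed 3-form and `½[π, π] = π♯(φ)`. -/
def BivectorField.IsTwistedPoisson (π : BivectorField E P) (φ : DiffForm E P 3) : Prop :=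
  φ.IsClosed ∧ ∀ x, (1 / 2 : ℝ) • π.schouten π x = π.sharpForm φ x

end Bivector

/-! ### Distributions -/

section Distribution

universe u

variable {E : Type*} [NormedAddCommGroup E] [NormedSpace ℝ E]
  {P : Type u} [TopologicalSpace P] [ChartedSpace E P]

/-- The distribution `D` is regular: it has constant rank. -/
def IsRegularDistribution (D : ∀ x : P, Submodule ℝ (TangentSpace 𝓘(ℝ, E) x)) : Prop :=
  ∃ r : ℕ, ∀ x, Module.finrank ℝ (D x) = r

/-- The distribution `D` is integrable: through every point `x` of `P` there passes an integral
manifold of `D`, that is, an injectively immersed submanifold `j : O → P` whose tangent space at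
every `y ∈ O` is `D` at `j y`. -/
def IsIntegrableDistribution (D : ∀ x : P, Submodule ℝ (TangentSpace 𝓘(ℝ, E) x)) : Prop :=
  ∀ x : P, ∃ (r : ℕ) (O : Type u) (_ : TopologicalSpace O)
    (_ : ChartedSpace (EuclideanSpace ℝ (Fin r)) O) (_ : IsManifold (𝓡 r) ∞ O) (j : O → P),
    Manifold.IsImmersion (𝓡 r) 𝓘(ℝ, E) ∞ j ∧ Function.Injective j ∧ x ∈ Set.range j ∧
      ∀ y : O, (mfderiv (𝓡 r) 𝓘(ℝ, E) j y : TangentSpace (𝓡 r) y →ₗ[ℝ]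
        TangentSpace 𝓘(ℝ, E) (j y)).range = D (j y)

end Distribution

/-! The number π(α, β) = β(π♯α) = -α(π♯β) depends only on π♯α and π♯β, so (π♯α, π♯β) ↦ -π(α, β) is a
well-defined 2-form on the image D of π♯. Constant rank lets this form extend, near each point, to a
smooth 2-form on all of TP (`exists_local_form`). Being such an extension is an affine condition at
every point, so a partition of unity glues the local extensions into a global Ω
(`exists_inverting_form`). The twisting form is φ = dΩ.

The identity ½[π, π] = π♯(dΩ) is checked in a chart (`half_flatSchouten_eq`). Differentiating Ω(π♯α,
π♯β) = -π(α, β) for constant covectors expresses dΩ(π♯α, π♯β, π♯γ) through derivatives of π and the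
cyclic terms Ω([π♯α, π♯β], π♯γ). Integrability puts the bracket in D
(`lieBracket_mem_range_of_isIntegrable`); there Ω is determined by π and disappears from the
formula. What remains is the cyclic sum of the derivatives of π(β, γ) along π♯α, which is ½[π, π].
The choice of Ω off D plays no role. -/

open scoped Topology

/-! ### Smooth dependence of pullbacks on the form and the linear map -/

section SmoothPullback

variable {E F : Type*} [NormedAddCommGroup E] [NormedSpace ℝ E] [FiniteDimensional ℝ E]
  [NormedAddCommGroup F] [NormedSpace ℝ F] {k : ℕ}

theorem finiteDimensional_continuousMultilinearMap :
    FiniteDimensional ℝ (ContinuousMultilinearMap ℝ (fun _ : Fin k => E) ℝ) :=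
  Module.Finite.of_injective ({
      toFun := ContinuousMultilinearMap.toMultilinearMap
      map_add' := fun _ _ => rfl
      map_smul' := fun _ _ => rfl } :
      ContinuousMultilinearMap ℝ (fun _ : Fin k => E) ℝ →ₗ[ℝ] MultilinearMap ℝ (fun _ => E) ℝ)
    ContinuousMultilinearMap.toMultilinearMap_injective

/-- The pullback of an alternating form by a linear map depends smoothly on both arguments. -/
theorem contDiff_compContinuousLinearMap :
    ContDiff ℝ ∞ fun q : (F [⋀^Fin k]→L[ℝ] ℝ) × (E →L[ℝ] F) => q.1.compContinuousLinearMap q.2 := by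
  have := finiteDimensional_continuousMultilinearMap (E := E) (k := k)
  let ι : (E [⋀^Fin k]→L[ℝ] ℝ) →L[ℝ] ContinuousMultilinearMap ℝ (fun _ : Fin k => E) ℝ :=
    ContinuousAlternatingMap.toContinuousMultilinearMapCLM ℝ
  have hι : Function.Injective ι :=
    ContinuousAlternatingMap.toContinuousMultilinearMap_injective
  -- On multilinear maps, pullback is a continuous multilinear expression in the linear maps. A
  -- linear left inverse of the inclusion `ι`, continuous by finite dimension, carries smoothness
  -- back to alternating maps.
  obtain ⟨L, hL⟩ := ι.toLinearMap.exists_leftInverse_of_injective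
    ((LinearMap.ker_eq_bot (f := ι.toLinearMap)).2 hι)
  let L' := LinearMap.toContinuousLinearMap L
  have key : (fun q : (F [⋀^Fin k]→L[ℝ] ℝ) × (E →L[ℝ] F) => q.1.compContinuousLinearMap q.2) =
      fun q => L' (ContinuousMultilinearMap.compContinuousLinearMapContinuousMultilinear ℝ
        (fun _ : Fin k => E) (fun _ => F) ℝ (fun _ => q.2)
        (ContinuousAlternatingMap.toContinuousMultilinearMapCLM ℝ q.1)) := by
    funext q
    exact (LinearMap.congr_fun hL (q.1.compContinuousLinearMap q.2)).symm
  rw [key]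
  refine L'.contDiff.comp (ContDiff.clm_apply ?_ ?_)
  · exact (ContinuousMultilinearMap.contDiff _).comp (contDiff_pi.2 fun _ => contDiff_snd)
  · exact (ContinuousLinearMap.contDiff (𝕜 := ℝ) (E := F [⋀^Fin k]→L[ℝ] ℝ)
      (F := ContinuousMultilinearMap ℝ (fun _ : Fin k => F) ℝ)
      (ContinuousAlternatingMap.toContinuousMultilinearMapCLM ℝ)).comp contDiff_fst

end SmoothPullback

/-! ### Brackets of vector fields tangent to a submanifold -/

section Involutive

variable {E G : Type*} [NormedAddCommGroup E] [NormedSpace ℝ E]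
  [NormedAddCommGroup G] [NormedSpace ℝ G]

/-- A vector field tangent to a parametrized submanifold with a smooth retraction lifts to the
parameter space. -/
theorem exists_lift_of_tangent {J : G → E} {S : E → G} {z : G} {X : E → E}
    (hJ : ContDiffAt ℝ 2 J z) (hS : ContDiffAt ℝ 2 S (J z)) (hSJ : ∀ᶠ w in 𝓝 z, S (J w) = w)
    (hX : DifferentiableAt ℝ X (J z)) (hXJ : ∀ᶠ w in 𝓝 z, X (J w) ∈ (fderiv ℝ J w).range) :
    ∃ a : G → G, DifferentiableAt ℝ a z ∧ ∀ᶠ w in 𝓝 z, X (J w) = fderiv ℝ J w (a w) := by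
  -- Since S ∘ J = id near z, dS is a left inverse of dJ, so dS(X) is the only possible lift; its
  -- formula makes it differentiable.
  refine ⟨fun w => fderiv ℝ S (J w) (X (J w)), ?_, ?_⟩
  · have hJ' := hJ.differentiableAt two_ne_zero
    have h1 : DifferentiableAt ℝ (fderiv ℝ S) (J z) :=
      (hS.fderiv_right (m := 1) (by norm_num)).differentiableAt one_ne_zero
    exact (h1.comp z hJ').clm_apply (hX.comp z hJ')
  · have h1 : ∀ᶠ w in 𝓝 z, ContDiffAt ℝ 2 J w := hJ.eventually (by simp)
    have h2 : ∀ᶠ w in 𝓝 z, ContDiffAt ℝ 2 S (J w) :=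
      hJ.continuousAt.eventually (hS.eventually (by simp))
    filter_upwards [h1, h2, hSJ.eventually_nhds, hXJ] with w h1 h2 h3 ⟨u, hu⟩
    have h4 : fderiv ℝ (S ∘ J) w = (fderiv ℝ S (J w)).comp (fderiv ℝ J w) :=
      fderiv_comp w (h2.differentiableAt two_ne_zero) (h1.differentiableAt two_ne_zero)
    have h5 : fderiv ℝ (S ∘ J) w = ContinuousLinearMap.id ℝ G := by
      rw [← fderiv_id (x := w)]
      exact Filter.EventuallyEq.fderiv_eq h3
    have h6 : fderiv ℝ S (J w) (fderiv ℝ J w u) = u := by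
      have := DFunLike.congr_fun (h4.symm.trans h5) u
      simpa using this
    replace hu : fderiv ℝ J w u = X (J w) := hu
    rw [← hu, h6]

/-- The Lie bracket of two vector fields tangent to a submanifold is tangent to it. -/
theorem lieBracket_mem_range_of_tangent {J : G → E} {S : E → G} {z : G} {X Y : E → E}
    (hJ : ContDiffAt ℝ 2 J z) (hS : ContDiffAt ℝ 2 S (J z)) (hSJ : ∀ᶠ w in 𝓝 z, S (J w) = w)
    (hX : DifferentiableAt ℝ X (J z)) (hXJ : ∀ᶠ w in 𝓝 z, X (J w) ∈ (fderiv ℝ J w).range)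
    (hY : DifferentiableAt ℝ Y (J z)) (hYJ : ∀ᶠ w in 𝓝 z, Y (J w) ∈ (fderiv ℝ J w).range) :
    VectorField.lieBracket ℝ X Y (J z) ∈ (fderiv ℝ J z).range := by
  obtain ⟨a, ha, haX⟩ := exists_lift_of_tangent hJ hS hSJ hX hXJ
  obtain ⟨b, hb, hbY⟩ := exists_lift_of_tangent hJ hS hSJ hY hYJ
  have hJ' := hJ.differentiableAt two_ne_zero
  have hJ2 : DifferentiableAt ℝ (fderiv ℝ J) z :=
    (hJ.fderiv_right (m := 1) (by norm_num)).differentiableAt one_ne_zero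
  have key : ∀ {X : E → E} {a : G → G}, DifferentiableAt ℝ X (J z) → DifferentiableAt ℝ a z →
      (∀ᶠ w in 𝓝 z, X (J w) = fderiv ℝ J w (a w)) → ∀ v,
      fderiv ℝ X (J z) (fderiv ℝ J z v) =
        fderiv ℝ (fderiv ℝ J) z v (a z) + fderiv ℝ J z (fderiv ℝ a z v) := by
    intro X a hX ha h v
    have h1 : fderiv ℝ (X ∘ J) z = (fderiv ℝ X (J z)).comp (fderiv ℝ J z) :=
      fderiv_comp z hX hJ'
    have h2 : fderiv ℝ (X ∘ J) z = fderiv ℝ (fun w => fderiv ℝ J w (a w)) z :=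
      Filter.EventuallyEq.fderiv_eq h
    rw [fderiv_clm_apply hJ2 ha] at h2
    have := DFunLike.congr_fun (h1.symm.trans h2) v
    simpa [add_comm] using this
  have hsymm : IsSymmSndFDerivAt ℝ J z := hJ.isSymmSndFDerivAt (by simp)
  -- The bracket of the lifts lifts the bracket: the two second-derivative terms of J cancel by
  -- symmetry.
  refine ⟨fderiv ℝ b z (a z) - fderiv ℝ a z (b z), ?_⟩
  rw [VectorField.lieBracket, haX.self_of_nhds, hbY.self_of_nhds, key hX ha haX, key hY hb hbY,
    hsymm.eq (a z) (b z)]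
  simp

end Involutive

/-! ### The identity ½[p, p] = p♯(dw) in a vector space -/

section PointwiseIdentity

variable {E : Type*} [NormedAddCommGroup E] [NormedSpace ℝ E] [FiniteDimensional ℝ E]

/-- The 2-form `w` restricts to minus the inverse of the bivector `p` on the image of `p♯`. -/
def InvertsBivector (p : (E →L[ℝ] ℝ) [⋀^Fin 2]→L[ℝ] ℝ) (w : E [⋀^Fin 2]→L[ℝ] ℝ) : Prop :=
  ∀ α β : E →L[ℝ] ℝ, w ![bivectorSharp p α, bivectorSharp p β] = -p ![α, β]

omit [FiniteDimensional ℝ E] in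
theorem eq_of_forall_dual_eq {v w : E} (h : ∀ β : E →L[ℝ] ℝ, β v = β w) : v = w :=
  (SeparatingDual.eq_iff_forall_dual_eq (R := ℝ)).2 h

variable (E) in
/-- The map `p ↦ p♯` as a continuous linear map. -/
noncomputable def bivectorSharpL :
    ((E →L[ℝ] ℝ) [⋀^Fin 2]→L[ℝ] ℝ) →ₗ[ℝ] ((E →L[ℝ] ℝ) →L[ℝ] E) where
  toFun := bivectorSharp
  map_add' p q := by
    ext α
    refine eq_of_forall_dual_eq fun β => ?_
    simp [apply_bivectorSharp]
  map_smul' c p := by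
    ext α
    refine eq_of_forall_dual_eq fun β => ?_
    simp [apply_bivectorSharp]

/-- Makes every linear map out of the space of bivectors, such as p ↦ p♯, automatically continuous
and hence differentiable. -/
theorem finiteDimensional_continuousAlternatingMap {F : Type*} [NormedAddCommGroup F]
    [NormedSpace ℝ F] [FiniteDimensional ℝ F] {k : ℕ} :
    FiniteDimensional ℝ (F [⋀^Fin k]→L[ℝ] ℝ) :=
  have := finiteDimensional_continuousMultilinearMap (E := F) (k := k)
  let ι : (F [⋀^Fin k]→L[ℝ] ℝ) →L[ℝ] ContinuousMultilinearMap ℝ (fun _ : Fin k => F) ℝ :=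
    ContinuousAlternatingMap.toContinuousMultilinearMapCLM ℝ
  Module.Finite.of_injective ι.toLinearMap
    ContinuousAlternatingMap.toContinuousMultilinearMap_injective

omit [FiniteDimensional ℝ E] in
theorem fderiv_linearMap_comp {V F : Type*} [NormedAddCommGroup V] [NormedSpace ℝ V]
    [FiniteDimensional ℝ V] [NormedAddCommGroup F] [NormedSpace ℝ F] (L : V →ₗ[ℝ] F)
    {p : E → V} {y : E} (hp : DifferentiableAt ℝ p y) :
    DifferentiableAt ℝ (fun z => L (p z)) y ∧
      ∀ v, fderiv ℝ (fun z => L (p z)) y v = L (fderiv ℝ p y v) := by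
  have h : HasFDerivAt (fun z => L (p z)) (LinearMap.toContinuousLinearMap L ∘L fderiv ℝ p y) y :=
    (LinearMap.toContinuousLinearMap L).hasFDerivAt.comp y hp.hasFDerivAt
  refine ⟨h.differentiableAt, fun v => ?_⟩
  rw [h.fderiv]
  rfl

theorem fderiv_bivectorSharp_apply {p : E → (E →L[ℝ] ℝ) [⋀^Fin 2]→L[ℝ] ℝ} {y : E}
    (hp : DifferentiableAt ℝ p y) (α : E →L[ℝ] ℝ) :
    DifferentiableAt ℝ (fun y => bivectorSharp (p y) α) y ∧
      ∀ v, fderiv ℝ (fun y => bivectorSharp (p y) α) y v = bivectorSharp (fderiv ℝ p y v) α := by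
  have := finiteDimensional_continuousAlternatingMap (F := E →L[ℝ] ℝ) (k := 2)
  let e : ((E →L[ℝ] ℝ) →L[ℝ] E) →L[ℝ] E := ContinuousLinearMap.apply ℝ E α
  exact fderiv_linearMap_comp (E := E) (V := (E →L[ℝ] ℝ) [⋀^Fin 2]→L[ℝ] ℝ) (F := E)
    (e.toLinearMap ∘ₗ bivectorSharpL E) hp

/-- Differentiating the relation between `p` and a 2-form that inverts it. -/
theorem fderiv_invertsBivector {p : E → (E →L[ℝ] ℝ) [⋀^Fin 2]→L[ℝ] ℝ}
    {w : E → E [⋀^Fin 2]→L[ℝ] ℝ} {y : E}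
    (hp : DifferentiableAt ℝ p y) (hw : DifferentiableAt ℝ w y)
    (hpw : ∀ᶠ z in 𝓝 y, InvertsBivector (p z) (w z)) (α β : E →L[ℝ] ℝ) (v : E) :
    fderiv ℝ w y v ![bivectorSharp (p y) α, bivectorSharp (p y) β] =
      -fderiv ℝ p y v ![α, β] - w y ![bivectorSharp (fderiv ℝ p y v) α, bivectorSharp (p y) β]
        - w y ![bivectorSharp (p y) α, bivectorSharp (fderiv ℝ p y v) β] := by
  obtain ⟨dα, eα⟩ := fderiv_bivectorSharp_apply hp α
  obtain ⟨dβ, eβ⟩ := fderiv_bivectorSharp_apply hp β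
  let g : Fin 2 → E → E := ![fun z => bivectorSharp (p z) α, fun z => bivectorSharp (p z) β]
  have hg : ∀ i, DifferentiableAt ℝ (g i) y := by
    intro i
    fin_cases i
    exacts [dα, dβ]
  have hgv : ∀ z, (fun i => g i z) = ![bivectorSharp (p z) α, bivectorSharp (p z) β] := by
    intro z
    funext i
    fin_cases i <;> rfl
  have h1 := fderiv_continuousAlternatingMap_apply_apply hw hg v
  have h2 : fderiv ℝ (fun z => w z fun i => g i z) y = fderiv ℝ (fun z => -p z ![α, β]) y := by
    refine Filter.EventuallyEq.fderiv_eq ?_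
    filter_upwards [hpw] with z hz
    rw [hgv]
    exact hz α β
  have h3 : fderiv ℝ (fun z => -p z ![α, β]) y v = -fderiv ℝ p y v ![α, β] := by
    rw [fderiv_fun_neg, _root_.neg_apply,
      fderiv_continuousAlternatingMap_apply_const_apply hp]
  rw [h2, h3, Fin.sum_univ_two, hgv] at h1
  have u0 : ∀ u, Function.update ![bivectorSharp (p y) α, bivectorSharp (p y) β] 0 u =
      ![u, bivectorSharp (p y) β] := by
    intro u; funext i; fin_cases i <;> rfl
  have u1 : ∀ u, Function.update ![bivectorSharp (p y) α, bivectorSharp (p y) β] 1 u =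
      ![bivectorSharp (p y) α, u] := by
    intro u; funext i; fin_cases i <;> rfl
  rw [u0, u1] at h1
  simp only [g, Matrix.cons_val_zero, Matrix.cons_val_one] at h1
  rw [eα, eβ] at h1
  linarith

omit [FiniteDimensional ℝ E] in
theorem form_apply_swap (w : E [⋀^Fin 2]→L[ℝ] ℝ) (u v : E) : w ![u, v] = -w ![v, u] := by
  have h := w.map_swap ![v, u] (i := 0) (j := 1) (by decide)
  have e : ![v, u] ∘ Equiv.swap (0 : Fin 2) 1 = ![u, v] := by
    funext i; fin_cases i <;> rfl
  rwa [e] at h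

omit [FiniteDimensional ℝ E] in
theorem form_apply_sub_left (w : E [⋀^Fin 2]→L[ℝ] ℝ) (u u' v : E) :
    w ![u - u', v] = w ![u, v] - w ![u', v] := by
  have h := w.map_update_sub ![0, v] 0 u u'
  have e (x : E) : Function.update ![0, v] 0 x = ![x, v] := by
    funext i; fin_cases i <;> rfl
  rwa [e, e, e] at h

theorem alternatizeUncurryFin_apply_three {F : Type*} [NormedAddCommGroup F] [NormedSpace ℝ F]
    (f : F →L[ℝ] F [⋀^Fin 2]→L[ℝ] ℝ) (v : Fin 3 → F) :
    ContinuousAlternatingMap.alternatizeUncurryFin f v =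
      f (v 0) ![v 1, v 2] - f (v 1) ![v 0, v 2] + f (v 2) ![v 0, v 1] := by
  rw [ContinuousAlternatingMap.alternatizeUncurryFin_apply, Fin.sum_univ_three]
  have e0 : (0 : Fin 3).removeNth v = ![v 1, v 2] := by funext i; fin_cases i <;> rfl
  have e1 : (1 : Fin 3).removeNth v = ![v 0, v 2] := by funext i; fin_cases i <;> rfl
  have e2 : (2 : Fin 3).removeNth v = ![v 0, v 1] := by funext i; fin_cases i <;> rfl
  rw [e0, e1, e2]
  simp
  ring

/-- If `w` inverts `p` and the image of `p♯` is involutive at `y`, then `½[p, p] = p♯(dw)`. -/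
theorem half_flatSchouten_eq {p : E → (E →L[ℝ] ℝ) [⋀^Fin 2]→L[ℝ] ℝ}
    {w : E → E [⋀^Fin 2]→L[ℝ] ℝ} {y : E}
    (hp : DifferentiableAt ℝ p y) (hw : DifferentiableAt ℝ w y)
    (hpw : ∀ᶠ z in 𝓝 y, InvertsBivector (p z) (w z))
    (hinv : ∀ α β : E →L[ℝ] ℝ, VectorField.lieBracket ℝ (fun z => bivectorSharp (p z) α)
      (fun z => bivectorSharp (p z) β) y ∈ (bivectorSharp (p y)).range) :
    (1 / 2 : ℝ) • flatSchouten p p y =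
      (extDeriv w y).compContinuousLinearMap (bivectorSharp (p y)) := by
  -- The left side is w([p♯α, p♯β], p♯γ). Involutivity writes the bracket as p♯η, so w inverts p on
  -- it and the value is -γ([p♯α, p♯β]), free of w.
  have key : ∀ α β γ : E →L[ℝ] ℝ,
      w y ![bivectorSharp (fderiv ℝ p y (bivectorSharp (p y) α)) β, bivectorSharp (p y) γ] -
      w y ![bivectorSharp (fderiv ℝ p y (bivectorSharp (p y) β)) α, bivectorSharp (p y) γ] =
      -(fderiv ℝ p y (bivectorSharp (p y) α) ![β, γ] -
        fderiv ℝ p y (bivectorSharp (p y) β) ![α, γ]) := by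
    intro α β γ
    obtain ⟨η, hη⟩ := hinv α β
    replace hη : bivectorSharp (p y) η = _ := hη
    rw [VectorField.lieBracket, (fderiv_bivectorSharp_apply hp α).2,
      (fderiv_bivectorSharp_apply hp β).2] at hη
    rw [← form_apply_sub_left, ← hη, hpw.self_of_nhds η γ,
      ← apply_bivectorSharp, hη, map_sub, apply_bivectorSharp, apply_bivectorSharp]
  ext v
  have hD := fderiv_invertsBivector hp hw hpw
  have h1 := key (v 0) (v 1) (v 2)
  have h2 := key (v 1) (v 2) (v 0)
  have h3 := key (v 2) (v 0) (v 1)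
  rw [ContinuousAlternatingMap.smul_apply, flatSchouten,
    ContinuousAlternatingMap.compContinuousLinearMap_apply, extDeriv,
    alternatizeUncurryFin_apply_three, alternatizeUncurryFin_apply_three]
  simp only [Function.comp_apply, hD, _root_.add_apply,
    ContinuousLinearMap.comp_apply, ContinuousAlternatingMap.add_apply, smul_eq_mul]
  simp only [form_apply_swap _ (bivectorSharp (p y) _)
    (bivectorSharp (fderiv ℝ p y (bivectorSharp (p y) _)) _)]
  have s0 := bivector_apply_swap (fderiv ℝ p y (bivectorSharp (p y) (v 1))) (v 2) (v 0)
  have s1 := bivector_apply_swap (fderiv ℝ p y (bivectorSharp (p y) (v 0))) (v 2) (v 1)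
  have s2 := bivector_apply_swap (fderiv ℝ p y (bivectorSharp (p y) (v 2))) (v 1) (v 0)
  -- In dw the terms containing w group into -w([p♯α, p♯β], p♯γ) and its cyclic permutations. By
  -- `key` these contribute twice the cyclic sum of (∂p along p♯α)(β, γ), while the remaining terms
  -- contribute minus that sum once.
  linarith

end PointwiseIdentity

/-! ### Local 2-forms inverting a bivector field of constant rank -/

section LocalForm

variable {E : Type*} [NormedAddCommGroup E] [NormedSpace ℝ E]

/-- The alternating form `(u, v) ↦ (A u v - A v u) / 2` of a bilinear form `A`. -/
noncomputable def alternatingPart :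
    (E →L[ℝ] E →L[ℝ] ℝ) →L[ℝ] E [⋀^Fin 2]→L[ℝ] ℝ :=
  (1 / 2 : ℝ) • (ContinuousAlternatingMap.alternatizeUncurryFinCLM ℝ E ℝ (n := 1)) ∘L
    ContinuousLinearMap.compL ℝ E (E →L[ℝ] ℝ) (E [⋀^Fin 1]→L[ℝ] ℝ)
      ((ContinuousAlternatingMap.ofSubsingletonLIE (𝕜 := ℝ) (E := E) (F := ℝ)
        (0 : Fin 1)).toContinuousLinearEquiv :
        (E →L[ℝ] ℝ) →L[ℝ] E [⋀^Fin 1]→L[ℝ] ℝ)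

theorem alternatingPart_apply (A : E →L[ℝ] E →L[ℝ] ℝ) (u v : E) :
    alternatingPart A ![u, v] = (1 / 2 : ℝ) * (A u v - A v u) := by
  have : alternatingPart A ![u, v] = (1 / 2 : ℝ) *
      ContinuousAlternatingMap.alternatizeUncurryFin
        (((ContinuousAlternatingMap.ofSubsingletonLIE (𝕜 := ℝ) (E := E) (F := ℝ)
        (0 : Fin 1)).toContinuousLinearEquiv :
        (E →L[ℝ] ℝ) →L[ℝ] E [⋀^Fin 1]→L[ℝ] ℝ) ∘L A) ![u, v] := rfl
  rw [this, ContinuousAlternatingMap.alternatizeUncurryFin_apply, Fin.sum_univ_two]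
  have h0 : ∀ (u : E) (m : Fin 1 → E),
    (((ContinuousAlternatingMap.ofSubsingletonLIE (𝕜 := ℝ) (E := E) (F := ℝ)
        (0 : Fin 1)).toContinuousLinearEquiv :
        (E →L[ℝ] ℝ) →L[ℝ] E [⋀^Fin 1]→L[ℝ] ℝ) ∘L A) u m = A u (m 0) := fun _ _ => rfl
  simp only [h0]
  simp [Fin.removeNth, sub_eq_add_neg]

variable [FiniteDimensional ℝ E]

/-- The restriction of bivectors to a subspace of covectors, as a continuous linear map. -/
theorem exists_restrictBivector {V : Type*} [NormedAddCommGroup V] [NormedSpace ℝ V]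
    [FiniteDimensional ℝ V] (i : V →L[ℝ] E →L[ℝ] ℝ) :
    ∃ B : ((E →L[ℝ] ℝ) [⋀^Fin 2]→L[ℝ] ℝ) →L[ℝ] (V →L[ℝ] V →L[ℝ] ℝ),
      ∀ q a b, B q a b = q ![i a, i b] := by
  have := finiteDimensional_continuousAlternatingMap (F := E →L[ℝ] ℝ) (k := 2)
  let B₀ : ((E →L[ℝ] ℝ) [⋀^Fin 2]→L[ℝ] ℝ) →ₗ[ℝ] (V →L[ℝ] V →L[ℝ] ℝ) :=
    { toFun := fun q => i.flip ∘L bivectorSharp q ∘L i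
      map_add' := fun q q' => by
        ext a b
        simp [apply_bivectorSharp]
      map_smul' := fun c q => by
        ext a b
        simp [apply_bivectorSharp] }
  refine ⟨LinearMap.toContinuousLinearMap (𝕜 := ℝ) (E := (E →L[ℝ] ℝ) [⋀^Fin 2]→L[ℝ] ℝ)
    (F' := V →L[ℝ] V →L[ℝ] ℝ) B₀, fun q a b => ?_⟩
  exact apply_bivectorSharp q (i a) (i b)

/-- Applied to the kernel of p♯ at a base point: the complement consists of covectors on which p is
nondegenerate there, and its parametrization stays fixed as the point moves. -/
theorem exists_parametrized_complement {D : Type*} [NormedAddCommGroup D] [NormedSpace ℝ D]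
    [FiniteDimensional ℝ D] (K : Submodule ℝ D) :
    ∃ (n : ℕ) (i : EuclideanSpace ℝ (Fin n) →L[ℝ] D), Function.Injective i ∧
      IsCompl K i.toLinearMap.range := by
  obtain ⟨W, hW⟩ := Submodule.exists_isCompl K
  let e := LinearEquiv.ofFinrankEq (EuclideanSpace ℝ (Fin (Module.finrank ℝ W))) W
    finrank_euclideanSpace_fin
  refine ⟨Module.finrank ℝ W, LinearMap.toContinuousLinearMap (W.subtype ∘ₗ e.toLinearMap),
    W.injective_subtype.comp e.injective, ?_⟩
  have : (W.subtype ∘ₗ e.toLinearMap).range = W := by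
    rw [LinearMap.range_comp_of_range_eq_top _ e.range, Submodule.range_subtype]
  change IsCompl K (W.subtype ∘ₗ e.toLinearMap).range
  rwa [this]

/-- Near a point, a bivector field of constant rank is inverted by a smooth 2-form. -/
theorem exists_local_form {p : E → (E →L[ℝ] ℝ) [⋀^Fin 2]→L[ℝ] ℝ} {y₀ : E} {r : ℕ}
    (hp : ∀ᶠ y in 𝓝 y₀, ContDiffAt ℝ ∞ p y)
    (hr : ∀ᶠ y in 𝓝 y₀, Module.finrank ℝ (bivectorSharp (p y)).range = r) :
    ∃ w : E → E [⋀^Fin 2]→L[ℝ] ℝ,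
      ∀ᶠ y in 𝓝 y₀, ContDiffAt ℝ ∞ w y ∧ InvertsBivector (p y) (w y) := by
  have : CompleteSpace E := FiniteDimensional.complete ℝ E
  obtain ⟨n, i, hi, hW⟩ := exists_parametrized_complement (bivectorSharp (p y₀)).toLinearMap.ker
  obtain ⟨B, hB⟩ := exists_restrictBivector i
  -- `B (p y)` is p restricted to the complement W = range i. Where it is invertible, `A y` sends
  -- p♯(i a) back to i a, so it inverts p♯ on p♯(W) and is defined on all of E.
  let A : E → E →L[ℝ] E →L[ℝ] ℝ := fun y => i ∘L (B (p y)).inverse ∘L i.flip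
  have hn : n = r := by
    have h1 := (bivectorSharp (p y₀)).toLinearMap.finrank_range_add_finrank_ker
    have h2 := Submodule.finrank_add_eq_of_isCompl hW
    have h3 := hr.self_of_nhds
    have h4 := LinearMap.finrank_range_of_inj (f := i.toLinearMap) hi
    rw [finrank_euclideanSpace_fin] at h4
    omega
  -- If p♯(i a) is annihilated by W, then, being annihilated by ker p♯ through skew-symmetry, it is
  -- zero. So i a lies in W ∩ ker p♯ = 0.
  have hinv₀ : (B (p y₀)).IsInvertible := by
    have hinj : Function.Injective (B (p y₀)).toLinearMap := by
      rw [← LinearMap.ker_eq_bot, LinearMap.ker_eq_bot']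
      intro a ha
      have hk : i a ∈ (bivectorSharp (p y₀)).toLinearMap.ker := by
        refine (eq_of_forall_dual_eq fun β => ?_ : bivectorSharp (p y₀) (i a) = 0)
        have hβ : β ∈ (bivectorSharp (p y₀)).toLinearMap.ker ⊔ i.toLinearMap.range := by
          rw [hW.sup_eq_top]; trivial
        obtain ⟨k, hk, _, ⟨b, rfl⟩, rfl⟩ := Submodule.mem_sup.1 hβ
        have hk' : bivectorSharp (p y₀) k = 0 := hk
        have h1 : k (bivectorSharp (p y₀) (i a)) = 0 := by
          rw [apply_bivectorSharp, bivector_apply_swap, ← apply_bivectorSharp, hk', map_zero,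
            neg_zero]
        have h2 : i b (bivectorSharp (p y₀) (i a)) = 0 := by
          rw [apply_bivectorSharp, ← hB]
          exact DFunLike.congr_fun ha b
        simp [h1, h2]
      exact hi ((Submodule.disjoint_def.1 hW.disjoint _ hk ⟨a, rfl⟩).trans (map_zero i).symm)
    have hd : Module.finrank ℝ (EuclideanSpace ℝ (Fin n)) =
        Module.finrank ℝ (EuclideanSpace ℝ (Fin n) →L[ℝ] ℝ) := by
      rw [← (LinearMap.toContinuousLinearMap : (EuclideanSpace ℝ (Fin n) →ₗ[ℝ] ℝ) ≃ₗ[ℝ]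
        (EuclideanSpace ℝ (Fin n) →L[ℝ] ℝ)).finrank_eq]
      exact (Subspace.dual_finrank_eq).symm
    let e := (LinearEquiv.ofInjectiveOfFinrankEq (B (p y₀)).toLinearMap hinj hd)
    exact ⟨e.toContinuousLinearEquiv, by ext; rfl⟩
  have hcont : ContinuousAt (fun y => B (p y)) y₀ :=
    B.continuous.continuousAt.comp hp.self_of_nhds.continuousAt
  have hinv : ∀ᶠ y in 𝓝 y₀, (B (p y)).IsInvertible := by
    obtain ⟨e, he⟩ := hinv₀
    have := ContinuousLinearEquiv.nhds e
    rw [he] at this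
    filter_upwards [hcont.eventually this] with y hy
    exact hy
  refine ⟨fun y => alternatingPart (A y), ?_⟩
  filter_upwards [hp, hr, hinv] with y hpy hry hy
  constructor
  · have hBs : ContDiff ℝ ∞ fun q => B q :=
      ContinuousLinearMap.contDiff (𝕜 := ℝ) (E := (E →L[ℝ] ℝ) [⋀^Fin 2]→L[ℝ] ℝ)
        (F := EuclideanSpace ℝ (Fin n) →L[ℝ] EuclideanSpace ℝ (Fin n) →L[ℝ] ℝ) B
    have h0 : ContDiffAt ℝ ∞ (fun y => B (p y)) y :=
      ContDiffAt.comp (g := fun q => B q) (f := p) y hBs.contDiffAt hpy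
    have h1 : ContDiffAt ℝ ∞ (fun y => (B (p y)).inverse) y :=
      ContDiffAt.comp (g := ContinuousLinearMap.inverse) (f := fun y => B (p y)) y
        hy.contDiffAt_map_inverse h0
    have h2 : ContDiffAt ℝ ∞ A y :=
      contDiffAt_const.clm_comp (h1.clm_comp contDiffAt_const)
    exact alternatingPart.contDiff.contDiffAt.comp y h2
  · have hBinv : ∀ a, (B (p y)).inverse (B (p y) a) = a := by
      obtain ⟨e, he⟩ := hy
      intro a
      rw [← he]
      simp
    have hRB : ∀ a, i.flip (bivectorSharp (p y) (i a)) = B (p y) a := by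
      intro a
      refine ContinuousLinearMap.ext fun b => ?_
      rw [hB, ContinuousLinearMap.flip_apply, apply_bivectorSharp]
    have hA : ∀ a v, A y (bivectorSharp (p y) (i a)) v = i a v := by
      intro a v
      change i ((B (p y)).inverse (i.flip (bivectorSharp (p y) (i a)))) v = _
      rw [hRB, hBinv]
    -- Constant rank enters here: p♯ is injective on W, whose dimension is r, so p♯(W) fills the
    -- whole r-dimensional image of p♯ at nearby points too.
    have hsurj : ∀ α, ∃ a, bivectorSharp (p y) (i a) = bivectorSharp (p y) α := by
      let q := (bivectorSharp (p y)).toLinearMap ∘ₗ i.toLinearMap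
      have hinj : Function.Injective q := by
        intro a a' h
        have h : bivectorSharp (p y) (i a) = bivectorSharp (p y) (i a') := h
        rw [← hBinv a, ← hBinv a', ← hRB, ← hRB, h]
      have h1 : Module.finrank ℝ q.range = r := by
        rw [LinearMap.finrank_range_of_inj hinj, finrank_euclideanSpace_fin, hn]
      have h2 : q.range = (bivectorSharp (p y)).toLinearMap.range := by
        refine Submodule.eq_of_le_of_finrank_eq ?_ (h1.trans hry.symm)
        rintro _ ⟨a, rfl⟩
        exact ⟨i a, rfl⟩
      intro α
      have : bivectorSharp (p y) α ∈ (bivectorSharp (p y)).toLinearMap.range := ⟨α, rfl⟩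
      rw [← h2] at this
      exact this
    intro α β
    obtain ⟨a, ha⟩ := hsurj α
    obtain ⟨b, hb⟩ := hsurj β
    have h1 : A y (bivectorSharp (p y) α) (bivectorSharp (p y) β) = -p y ![α, β] := by
      rw [← ha, hA, apply_bivectorSharp, bivector_apply_swap, ← apply_bivectorSharp, ha,
        apply_bivectorSharp]
    have h2 : A y (bivectorSharp (p y) β) (bivectorSharp (p y) α) = p y ![α, β] := by
      rw [← hb, hA, apply_bivectorSharp, bivector_apply_swap, ← apply_bivectorSharp, hb,
        apply_bivectorSharp, bivector_apply_swap, neg_neg]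
    rw [alternatingPart_apply, h1, h2]
    ring

end LocalForm

theorem minSmoothness_two_le_infty : minSmoothness ℝ 2 ≤ (∞ : WithTop ℕ∞) := by
  rw [minSmoothness_of_isRCLikeNormedField]
  exact ENat.LEInfty.out

/-! ### Differential forms under change of charts -/

section Charts

variable {E : Type*} [NormedAddCommGroup E] [NormedSpace ℝ E]
  {P : Type*} [TopologicalSpace P] [ChartedSpace E P] [IsManifold 𝓘(ℝ, E) ∞ P]

/-- Keeping x as a variable tied to y by an equation avoids rewriting base points inside the types
of tangent vectors. -/
theorem mfderiv_symm_comp_extChartAt {x₀ x : P} {y : E} (hy : y ∈ (extChartAt 𝓘(ℝ, E) x₀).target)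
    (hx : (extChartAt 𝓘(ℝ, E) x₀).symm y = x) (v : TangentSpace 𝓘(ℝ, E) x) :
    (mfderiv 𝓘(ℝ, E) 𝓘(ℝ, E) (extChartAt 𝓘(ℝ, E) x₀).symm y
      (mfderiv 𝓘(ℝ, E) 𝓘(ℝ, E) (extChartAt 𝓘(ℝ, E) x₀) x v) : E) = v := by
  have : IsManifold 𝓘(ℝ, E) 1 P := .of_le (n := ∞) (by simp)
  subst hx
  have h := mfderivWithin_extChartAt_symm_comp_mfderiv_extChartAt (I := 𝓘(ℝ, E)) hy
  rw [modelWithCornersSelf_coe, Set.range_id, mfderivWithin_univ] at h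
  exact DFunLike.congr_fun h v

theorem contDiffAt_transition {x₀ x₁ : P} {y : E} (hy : y ∈ (extChartAt 𝓘(ℝ, E) x₀).target)
    (hs : (extChartAt 𝓘(ℝ, E) x₀).symm y ∈ (extChartAt 𝓘(ℝ, E) x₁).source) :
    ContDiffAt ℝ ∞ (extChartAt 𝓘(ℝ, E) x₁ ∘ (extChartAt 𝓘(ℝ, E) x₀).symm) y := by
  rw [← contMDiffAt_iff_contDiffAt]
  refine ContMDiffAt.comp y (contMDiffAt_extChartAt' (by simpa using hs)) ?_
  exact (contMDiffOn_extChartAt_symm x₀).contMDiffAt ((isOpen_extChartAt_target x₀).mem_nhds hy)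

theorem fderiv_transition {x₀ x₁ : P} {y : E} (hy : y ∈ (extChartAt 𝓘(ℝ, E) x₀).target)
    (hs : (extChartAt 𝓘(ℝ, E) x₀).symm y ∈ (extChartAt 𝓘(ℝ, E) x₁).source) :
    fderiv ℝ (extChartAt 𝓘(ℝ, E) x₁ ∘ (extChartAt 𝓘(ℝ, E) x₀).symm) y =
      (mfderiv 𝓘(ℝ, E) 𝓘(ℝ, E) (extChartAt 𝓘(ℝ, E) x₁) ((extChartAt 𝓘(ℝ, E) x₀).symm y)).comp
        (mfderiv 𝓘(ℝ, E) 𝓘(ℝ, E) (extChartAt 𝓘(ℝ, E) x₀).symm y) := by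
  rw [← mfderiv_eq_fderiv]
  refine mfderiv_comp y ?_ ?_
  · exact (contMDiffAt_extChartAt' (n := ∞) (by simpa using hs)).mdifferentiableAt (by simp)
  · exact ((contMDiffOn_extChartAt_symm (n := ∞) x₀).contMDiffAt
      ((isOpen_extChartAt_target x₀).mem_nhds hy)).mdifferentiableAt (by simp)

omit [IsManifold 𝓘(ℝ, E) ∞ P] in
theorem eventually_mem_transition {x₀ x₁ : P} {y : E} (hy : y ∈ (extChartAt 𝓘(ℝ, E) x₀).target)
    (hs : (extChartAt 𝓘(ℝ, E) x₀).symm y ∈ (extChartAt 𝓘(ℝ, E) x₁).source) :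
    ∀ᶠ z in 𝓝 y, z ∈ (extChartAt 𝓘(ℝ, E) x₀).target ∧
      (extChartAt 𝓘(ℝ, E) x₀).symm z ∈ (extChartAt 𝓘(ℝ, E) x₁).source :=
  ((isOpen_extChartAt_target x₀).eventually_mem hy).and
    ((continuousAt_extChartAt_symm'' hy).eventually
      ((isOpen_extChartAt_source x₁).eventually_mem hs))

variable {k : ℕ}

omit [IsManifold 𝓘(ℝ, E) ∞ P] in
theorem formInChart_of_eq (η : ∀ x : P, TangentSpace 𝓘(ℝ, E) x [⋀^Fin k]→L[ℝ] ℝ) {x₀ x : P}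
    {y : E} (hx : (extChartAt 𝓘(ℝ, E) x₀).symm y = x) (v : Fin k → E) :
    formInChart η x₀ y v =
      η x (fun i => (mfderiv 𝓘(ℝ, E) 𝓘(ℝ, E) (extChartAt 𝓘(ℝ, E) x₀).symm y (v i) : E)) := by
  subst hx
  rfl

/-- The change of charts formula for differential forms. -/
theorem formInChart_change (η : ∀ x : P, TangentSpace 𝓘(ℝ, E) x [⋀^Fin k]→L[ℝ] ℝ) {x₀ x₁ : P}
    {y : E} (hy : y ∈ (extChartAt 𝓘(ℝ, E) x₀).target)
    (hs : (extChartAt 𝓘(ℝ, E) x₀).symm y ∈ (extChartAt 𝓘(ℝ, E) x₁).source) :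
    formInChart η x₀ y = (formInChart η x₁
      ((extChartAt 𝓘(ℝ, E) x₁ ∘ (extChartAt 𝓘(ℝ, E) x₀).symm) y)).compContinuousLinearMap
        (fderiv ℝ (extChartAt 𝓘(ℝ, E) x₁ ∘ (extChartAt 𝓘(ℝ, E) x₀).symm) y) := by
  ext v
  refine Eq.trans ?_ (formInChart_of_eq η ((extChartAt 𝓘(ℝ, E) x₁).left_inv hs) _).symm
  refine congrArg (η _) (funext fun i => ?_)
  simp only
  rw [fderiv_transition hy hs]
  exact (mfderiv_symm_comp_extChartAt ((extChartAt 𝓘(ℝ, E) x₁).map_source hs)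
    ((extChartAt 𝓘(ℝ, E) x₁).left_inv hs) _).symm

omit [IsManifold 𝓘(ℝ, E) ∞ P] in
theorem DiffForm.contDiffAt_formInChart (η : DiffForm E P k) {x₀ : P} {y : E}
    (hy : y ∈ (extChartAt 𝓘(ℝ, E) x₀).target) : ContDiffAt ℝ ∞ (formInChart η.toFun x₀) y :=
  (η.smooth' x₀).contDiffAt ((isOpen_extChartAt_target x₀).mem_nhds hy)

/-- The exterior derivative may be computed in any chart. -/
theorem formInChart_extDerivAt (η : DiffForm E P k) {x₀ : P} {y : E}
    (hy : y ∈ (extChartAt 𝓘(ℝ, E) x₀).target) :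
    formInChart η.extDerivAt x₀ y = extDeriv (formInChart η.toFun x₀) y := by
  have hs := mem_extChartAt_source (I := 𝓘(ℝ, E)) ((extChartAt 𝓘(ℝ, E) x₀).symm y)
  -- The definition of dη at a point uses the chart around that point. The two chart expressions
  -- differ by pullback along the transition map, which commutes with d.
  have h1 : formInChart η.toFun x₀ =ᶠ[𝓝 y] fun z =>
      (formInChart η.toFun ((extChartAt 𝓘(ℝ, E) x₀).symm y) ((extChartAt 𝓘(ℝ, E)
        ((extChartAt 𝓘(ℝ, E) x₀).symm y) ∘
          (extChartAt 𝓘(ℝ, E) x₀).symm) z)).compContinuousLinearMap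
        (fderiv ℝ (extChartAt 𝓘(ℝ, E) ((extChartAt 𝓘(ℝ, E) x₀).symm y) ∘
          (extChartAt 𝓘(ℝ, E) x₀).symm) z) := by
    filter_upwards [eventually_mem_transition hy hs] with z hz
    exact formInChart_change _ hz.1 hz.2
  rw [h1.extDeriv_eq, extDeriv_pullback (r := ∞) _ (contDiffAt_transition hy hs)
    minSmoothness_two_le_infty,
    fderiv_transition hy hs]
  · rfl
  · exact (η.contDiffAt_formInChart (mem_extChartAt_target _)).differentiableAt (by simp)

/-- The exterior derivative of a smooth form, as a smooth form. -/
noncomputable def DiffForm.d (η : DiffForm E P k) : DiffForm E P (k + 1) where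
  toFun := η.extDerivAt
  smooth' x₀ := by
    have h : ContDiffOn ℝ ∞ (extDeriv (formInChart η.toFun x₀))
        (extChartAt 𝓘(ℝ, E) x₀).target :=
      (ContinuousAlternatingMap.alternatizeUncurryFinCLM ℝ E ℝ).contDiff.comp_contDiffOn
        ((η.smooth' x₀).fderiv_of_isOpen (isOpen_extChartAt_target x₀) (by simp))
    exact h.congr fun y hy => formInChart_extDerivAt η hy

theorem DiffForm.d_isExact (η : DiffForm E P k) : η.d.IsExact := ⟨η, fun _ => rfl⟩

theorem DiffForm.d_isClosed (η : DiffForm E P k) : η.d.IsClosed := by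
  intro x
  have h1 : formInChart η.d.toFun x =ᶠ[𝓝 (extChartAt 𝓘(ℝ, E) x x)]
      extDeriv (formInChart η.toFun x) := by
    filter_upwards [(isOpen_extChartAt_target x).mem_nhds (mem_extChartAt_target x)] with y hy
    exact formInChart_extDerivAt η hy
  rw [DiffForm.extDerivAt, h1.extDeriv_eq, extDeriv_extDeriv_apply (r := ∞)
    (η.contDiffAt_formInChart (mem_extChartAt_target x)) minSmoothness_two_le_infty]
  rfl

/-- Pullbacks of smooth forms by charts are smooth. -/
theorem contDiffAt_formInChart_pullback [FiniteDimensional ℝ E] {w : E → E [⋀^Fin k]→L[ℝ] ℝ}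
    {x₀ x₁ : P} {y : E} (hy : y ∈ (extChartAt 𝓘(ℝ, E) x₀).target)
    (hs : (extChartAt 𝓘(ℝ, E) x₀).symm y ∈ (extChartAt 𝓘(ℝ, E) x₁).source)
    (hw : ContDiffAt ℝ ∞ w (extChartAt 𝓘(ℝ, E) x₁ ((extChartAt 𝓘(ℝ, E) x₀).symm y))) :
    ContDiffAt ℝ ∞ (formInChart (fun x => (w (extChartAt 𝓘(ℝ, E) x₁ x)).compContinuousLinearMap
      (mfderiv 𝓘(ℝ, E) 𝓘(ℝ, E) (extChartAt 𝓘(ℝ, E) x₁) x)) x₀) y := by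
  have hτ := contDiffAt_transition hy hs
  have h1 : ContDiffAt ℝ ∞ (fun z => (w ((extChartAt 𝓘(ℝ, E) x₁ ∘
      (extChartAt 𝓘(ℝ, E) x₀).symm) z)).compContinuousLinearMap
        (fderiv ℝ (extChartAt 𝓘(ℝ, E) x₁ ∘ (extChartAt 𝓘(ℝ, E) x₀).symm) z)) y :=
    contDiff_compContinuousLinearMap.contDiffAt.comp y
      ((ContDiffAt.comp y hw hτ).prodMk (hτ.fderiv_right (by simp)))
  refine h1.congr_of_eventuallyEq ?_
  filter_upwards [eventually_mem_transition hy hs] with z hz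
  rw [fderiv_transition hz.1 hz.2]
  rfl

end Charts

/-! ### Bivector fields and their inverting forms in charts -/

section BivectorCharts

variable {E : Type*} [NormedAddCommGroup E] [NormedSpace ℝ E] [FiniteDimensional ℝ E]
  {P : Type*} [TopologicalSpace P] [ChartedSpace E P]

theorem BivectorField.apply_sharp (π : BivectorField E P) (x : P)
    (α β : TangentSpace 𝓘(ℝ, E) x →L[ℝ] ℝ) : β (π.sharp x α) = π.toFun x ![α, β] :=
  have : FiniteDimensional ℝ (TangentSpace 𝓘(ℝ, E) x) := inferInstanceAs (FiniteDimensional ℝ E)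
  have : T2Space (TangentSpace 𝓘(ℝ, E) x) := inferInstanceAs (T2Space E)
  apply_bivectorSharp (π.toFun x) α β

omit [FiniteDimensional ℝ E] in
theorem bivectorInChart_of_eq (π : BivectorField E P) {x₀ x : P} {y : E}
    (hx : (extChartAt 𝓘(ℝ, E) x₀).symm y = x) (α β : E →L[ℝ] ℝ) :
    bivectorInChart π.toFun x₀ y ![α, β] =
      π.toFun x ![α.comp (mfderiv 𝓘(ℝ, E) 𝓘(ℝ, E) (extChartAt 𝓘(ℝ, E) x₀) x),
        β.comp (mfderiv 𝓘(ℝ, E) 𝓘(ℝ, E) (extChartAt 𝓘(ℝ, E) x₀) x)] := by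
  subst hx
  rw [bivectorInChart, ContinuousAlternatingMap.compContinuousLinearMap_apply]
  congr 1
  funext i
  fin_cases i <;> rfl

theorem bivectorSharp_inChart (π : BivectorField E P) {x₀ x : P} {y : E}
    (hx : (extChartAt 𝓘(ℝ, E) x₀).symm y = x) (α : E →L[ℝ] ℝ) :
    bivectorSharp (bivectorInChart π.toFun x₀ y) α =
      mfderiv 𝓘(ℝ, E) 𝓘(ℝ, E) (extChartAt 𝓘(ℝ, E) x₀) x
        (π.sharp x (α.comp (mfderiv 𝓘(ℝ, E) 𝓘(ℝ, E) (extChartAt 𝓘(ℝ, E) x₀) x))) := by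
  refine eq_of_forall_dual_eq fun β => ?_
  rw [apply_bivectorSharp, bivectorInChart_of_eq π hx, ← π.apply_sharp]
  rfl

/-- The 2-form `w` on `T_x P` restricts to minus the inverse of `π` on the image of `π♯`. -/
def BivectorField.InvertedAt (π : BivectorField E P) (x : P)
    (w : TangentSpace 𝓘(ℝ, E) x [⋀^Fin 2]→L[ℝ] ℝ) : Prop :=
  ∀ α β : TangentSpace 𝓘(ℝ, E) x →L[ℝ] ℝ,
    w ![π.sharp x α, π.sharp x β] = -π.toFun x ![α, β]

variable [IsManifold 𝓘(ℝ, E) ∞ P]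

theorem bivectorSharp_inChart_comp_symm (π : BivectorField E P) {x₀ x : P} {y : E}
    (hy : y ∈ (extChartAt 𝓘(ℝ, E) x₀).target) (hx : (extChartAt 𝓘(ℝ, E) x₀).symm y = x)
    (α : TangentSpace 𝓘(ℝ, E) x →L[ℝ] ℝ) :
    bivectorSharp (bivectorInChart π.toFun x₀ y) ((α : E →L[ℝ] ℝ).comp
        (mfderiv 𝓘(ℝ, E) 𝓘(ℝ, E) (extChartAt 𝓘(ℝ, E) x₀).symm y : E →L[ℝ] E)) =
      mfderiv 𝓘(ℝ, E) 𝓘(ℝ, E) (extChartAt 𝓘(ℝ, E) x₀) x (π.sharp x α) := by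
  rw [bivectorSharp_inChart π hx]
  congr 2
  refine ContinuousLinearMap.ext fun v => ?_
  exact congrArg α (mfderiv_symm_comp_extChartAt hy hx v)

theorem range_bivectorSharp_inChart (π : BivectorField E P) {x₀ x : P} {y : E}
    (hy : y ∈ (extChartAt 𝓘(ℝ, E) x₀).target) (hx : (extChartAt 𝓘(ℝ, E) x₀).symm y = x) :
    (bivectorSharp (bivectorInChart π.toFun x₀ y)).toLinearMap.range =
      (π.charDistribution x).map
        (mfderiv 𝓘(ℝ, E) 𝓘(ℝ, E) (extChartAt 𝓘(ℝ, E) x₀) x).toLinearMap := by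
  ext v
  constructor
  · rintro ⟨α, rfl⟩
    exact ⟨_, ⟨_, rfl⟩, (bivectorSharp_inChart π hx α).symm⟩
  · rintro ⟨_, ⟨α, rfl⟩, rfl⟩
    exact ⟨_, bivectorSharp_inChart_comp_symm π hy hx α⟩

theorem finrank_range_bivectorSharp_inChart (π : BivectorField E P) {x₀ : P} {y : E}
    (hy : y ∈ (extChartAt 𝓘(ℝ, E) x₀).target) :
    Module.finrank ℝ (bivectorSharp (bivectorInChart π.toFun x₀ y)).range =
      Module.finrank ℝ (π.charDistribution ((extChartAt 𝓘(ℝ, E) x₀).symm y)) := by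
  set x := (extChartAt 𝓘(ℝ, E) x₀).symm y with hx
  let T := (mfderiv 𝓘(ℝ, E) 𝓘(ℝ, E) (extChartAt 𝓘(ℝ, E) x₀) x).toLinearMap
  have hT : Function.Injective T := by
    intro u v huv
    rw [← mfderiv_symm_comp_extChartAt hy hx.symm u, ← mfderiv_symm_comp_extChartAt hy hx.symm v]
    exact congrArg _ huv
  rw [range_bivectorSharp_inChart π hy hx.symm]
  exact (Submodule.equivMapOfInjective T hT _).finrank_eq.symm

theorem invertsBivector_inChart (π : BivectorField E P)
    (η : ∀ x : P, TangentSpace 𝓘(ℝ, E) x [⋀^Fin 2]→L[ℝ] ℝ) {x₀ : P} {y : E}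
    (hy : y ∈ (extChartAt 𝓘(ℝ, E) x₀).target)
    (h : π.InvertedAt _ (η ((extChartAt 𝓘(ℝ, E) x₀).symm y))) :
    InvertsBivector (bivectorInChart π.toFun x₀ y) (formInChart η x₀ y) := by
  intro α β
  rw [bivectorInChart_of_eq π rfl, formInChart_of_eq η rfl, bivectorSharp_inChart π rfl,
    bivectorSharp_inChart π rfl, ← h]
  congr 1
  funext i
  fin_cases i
  · exact mfderiv_symm_comp_extChartAt hy rfl _
  · exact mfderiv_symm_comp_extChartAt hy rfl _

theorem invertedAt_of_inChart (π : BivectorField E P) {w : E [⋀^Fin 2]→L[ℝ] ℝ} {x₀ x : P}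
    (hx : x ∈ (extChartAt 𝓘(ℝ, E) x₀).source)
    (h : InvertsBivector (bivectorInChart π.toFun x₀ (extChartAt 𝓘(ℝ, E) x₀ x)) w) :
    π.InvertedAt x (w.compContinuousLinearMap
      (mfderiv 𝓘(ℝ, E) 𝓘(ℝ, E) (extChartAt 𝓘(ℝ, E) x₀) x)) := by
  have hy := (extChartAt 𝓘(ℝ, E) x₀).map_source hx
  have hxy := (extChartAt 𝓘(ℝ, E) x₀).left_inv hx
  intro α β
  have e := h ((α : E →L[ℝ] ℝ).comp (mfderiv 𝓘(ℝ, E) 𝓘(ℝ, E) (extChartAt 𝓘(ℝ, E) x₀).symm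
      (extChartAt 𝓘(ℝ, E) x₀ x) : E →L[ℝ] E)) ((β : E →L[ℝ] ℝ).comp
      (mfderiv 𝓘(ℝ, E) 𝓘(ℝ, E) (extChartAt 𝓘(ℝ, E) x₀).symm
      (extChartAt 𝓘(ℝ, E) x₀ x) : E →L[ℝ] E))
  rw [← apply_bivectorSharp] at e
  rw [bivectorSharp_inChart_comp_symm π hy hxy α, bivectorSharp_inChart_comp_symm π hy hxy β] at e
  rw [← π.apply_sharp]
  refine Eq.trans ?_ (e.trans ?_)
  · refine congrArg w (funext fun i => ?_)
    fin_cases i <;> rfl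
  · exact congrArg (fun u => -β u) (mfderiv_symm_comp_extChartAt hy hxy (π.sharp x α))

end BivectorCharts

/-! ### Immersed submanifolds in a fixed chart -/

section Integrable

variable {E : Type*} [NormedAddCommGroup E] [NormedSpace ℝ E] [FiniteDimensional ℝ E]
  {P : Type*} [TopologicalSpace P] [ChartedSpace E P] [IsManifold 𝓘(ℝ, E) ∞ P]

omit [FiniteDimensional ℝ E] in
/-- In the chart around a point, an immersed submanifold is parametrized by a smooth map with a
smooth retraction. -/
theorem exists_parametrization_of_isImmersion {r : ℕ} {O : Type*} [TopologicalSpace O]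
    [ChartedSpace (EuclideanSpace ℝ (Fin r)) O] [IsManifold (𝓡 r) ∞ O] {j : O → P}
    (hj : Manifold.IsImmersion (𝓡 r) 𝓘(ℝ, E) ∞ j) (o : O) :
    ∃ (J : EuclideanSpace ℝ (Fin r) → E) (S : E → EuclideanSpace ℝ (Fin r))
      (z : EuclideanSpace ℝ (Fin r)),
      J z = extChartAt 𝓘(ℝ, E) (j o) (j o) ∧ ContDiffAt ℝ ∞ J z ∧ ContDiffAt ℝ ∞ S (J z) ∧
      (∀ᶠ w in 𝓝 z, S (J w) = w) ∧
      ∀ᶠ w in 𝓝 z, ∃ o' : O, j o' ∈ (extChartAt 𝓘(ℝ, E) (j o)).source ∧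
        J w = extChartAt 𝓘(ℝ, E) (j o) (j o') ∧
        (fderiv ℝ J w).toLinearMap.range =
          (mfderiv (𝓡 r) 𝓘(ℝ, E) j o').toLinearMap.range.map
            (mfderiv 𝓘(ℝ, E) 𝓘(ℝ, E) (extChartAt 𝓘(ℝ, E) (j o)) (j o')).toLinearMap := by
  have h := hj.isImmersionAt o
  have hjs := hj.contMDiff
  set φ := h.domChart
  set ψ := h.codChart
  have hφa : φ ∈ IsManifold.maximalAtlas (𝓡 r) ∞ O := h.domChart_mem_maximalAtlas
  have hψa : ψ ∈ IsManifold.maximalAtlas 𝓘(ℝ, E) ∞ P := h.codChart_mem_maximalAtlas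
  have ho : o ∈ φ.source := h.mem_domChart_source
  have hφo : φ.symm (φ o) = o := φ.left_inv ho
  let e := extChartAt 𝓘(ℝ, E) (j o)
  have hφs : ∀ w ∈ φ.target, ContMDiffAt (𝓡 r) (𝓡 r) ∞ φ.symm w := fun w hw =>
    (contMDiffOn_symm_of_mem_maximalAtlas hφa).contMDiffAt (φ.open_target.mem_nhds hw)
  have hφ' : ∀ w ∈ φ.source, ContMDiffAt (𝓡 r) (𝓡 r) ∞ φ w := fun w hw =>
    (contMDiffOn_of_mem_maximalAtlas hφa).contMDiffAt (φ.open_source.mem_nhds hw)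
  have hes : ∀ x ∈ e.source, ContMDiffAt 𝓘(ℝ, E) 𝓘(ℝ, E) ∞ e x := fun x hx =>
    contMDiffAt_extChartAt' (by simpa [e] using hx)
  have hz : φ o ∈ φ.target := φ.map_source ho
  have hev : ∀ᶠ w in 𝓝 (φ o), w ∈ φ.target ∧ j (φ.symm w) ∈ e.source := by
    refine (φ.open_target.eventually_mem hz).and ?_
    have hc : ContinuousAt (fun w => j (φ.symm w)) (φ o) :=
      hjs.continuous.continuousAt.comp (hφs _ hz).continuousAt
    refine hc.eventually ((isOpen_extChartAt_source (j o)).eventually_mem ?_)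
    change j (φ.symm (φ o)) ∈ _
    rw [hφo]
    exact mem_extChartAt_source (j o)
  -- J reads j in the domain chart of the immersion normal form and the preferred chart at j o. In
  -- the codomain chart ψ, j becomes w ↦ (w, 0) up to `h.equiv`, so the first component recovers w.
  refine ⟨fun w => e (j (φ.symm w)), fun y => (h.equiv.symm (ψ (e.symm y))).1, φ o, ?_, ?_, ?_,
    ?_, ?_⟩
  · simp only [hφo]
    rfl
  · rw [← contMDiffAt_iff_contDiffAt]
    refine ContMDiffAt.comp (I' := 𝓘(ℝ, E)) (g := e) (f := fun w => j (φ.symm w)) (φ o)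
      (hes _ hev.self_of_nhds.2) (hjs.contMDiffAt.comp (φ o) (hφs _ hz))
  · have hy := hev.self_of_nhds.2
    have h1 : ContDiffAt ℝ ∞ (fun y => ψ (e.symm y)) (e (j (φ.symm (φ o)))) := by
      rw [← contMDiffAt_iff_contDiffAt]
      refine ContMDiffAt.comp (I' := 𝓘(ℝ, E)) (g := ψ) (f := e.symm) _ ?_ ?_
      · rw [e.left_inv hy, hφo]
        exact (contMDiffOn_of_mem_maximalAtlas hψa).contMDiffAt
          (ψ.open_source.mem_nhds h.mem_codChart_source)
      · exact (contMDiffOn_extChartAt_symm (j o)).contMDiffAt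
          ((isOpen_extChartAt_target (j o)).mem_nhds (e.map_source hy))
    exact contDiffAt_fst.comp _ (h.equiv.symm.contDiff.contDiffAt.comp _ h1)
  · filter_upwards [hev] with w hw
    have h1 : ψ (j (φ.symm w)) = h.equiv (w, 0) := by
      have := h.writtenInCharts
        (show w ∈ (φ.extend (𝓡 r)).target by simpa using hw.1)
      simpa using this
    simp only [e.left_inv hw.2, h1, ContinuousLinearEquiv.symm_apply_apply]
  · filter_upwards [hev] with w hw
    refine ⟨φ.symm w, hw.2, rfl, ?_⟩
    have hsrc := φ.map_target hw.1
    have hd1 : MDifferentiableAt (𝓡 r) (𝓡 r) φ.symm w := (hφs w hw.1).mdifferentiableAt (by simp)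
    have hd2 : MDifferentiableAt (𝓡 r) 𝓘(ℝ, E) j (φ.symm w) :=
      hjs.contMDiffAt.mdifferentiableAt (by simp)
    have hd3 : MDifferentiableAt 𝓘(ℝ, E) 𝓘(ℝ, E) e (j (φ.symm w)) :=
      (hes _ hw.2).mdifferentiableAt (by simp)
    have hd4 : MDifferentiableAt (𝓡 r) (𝓡 r) φ (φ.symm w) :=
      (hφ' _ hsrc).mdifferentiableAt (by simp)
    have hJ : fderiv ℝ (fun w => e (j (φ.symm w))) w =
        (mfderiv 𝓘(ℝ, E) 𝓘(ℝ, E) e (j (φ.symm w))).comp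
          ((mfderiv (𝓡 r) 𝓘(ℝ, E) j (φ.symm w)).comp (mfderiv (𝓡 r) (𝓡 r) φ.symm w)) := by
      rw [← mfderiv_eq_fderiv]
      have h2 := mfderiv_comp w hd2 hd1
      rw [← h2]
      exact mfderiv_comp w hd3 (hd2.comp w hd1)
    -- This makes the differential of `φ.symm` surjective, so that passing to coordinates on O loses
    -- no tangent directions.
    have hid : (mfderiv (𝓡 r) (𝓡 r) φ.symm w).comp (mfderiv (𝓡 r) (𝓡 r) φ (φ.symm w)) =
        ContinuousLinearMap.id ℝ _ := by
      have h1 : mfderiv (𝓡 r) (𝓡 r) (φ.symm ∘ φ) (φ.symm w) =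
          (mfderiv (𝓡 r) (𝓡 r) φ.symm (φ (φ.symm w))).comp
            (mfderiv (𝓡 r) (𝓡 r) φ (φ.symm w)) :=
        mfderiv_comp _ (by rw [φ.right_inv hw.1]; exact hd1) hd4
      have h2 : φ.symm ∘ φ =ᶠ[𝓝 (φ.symm w)] id := by
        filter_upwards [φ.open_source.mem_nhds hsrc] with o' ho'
        exact φ.left_inv ho'
      rw [h2.mfderiv_eq, mfderiv_id, φ.right_inv hw.1] at h1
      exact h1.symm
    ext v
    constructor
    · rintro ⟨u, rfl⟩
      exact ⟨_, ⟨_, rfl⟩, (DFunLike.congr_fun hJ u).symm⟩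
    rintro ⟨_, ⟨u, rfl⟩, rfl⟩
    refine ⟨mfderiv (𝓡 r) (𝓡 r) φ (φ.symm w) u, ?_⟩
    have h5 := DFunLike.congr_fun hid u
    refine (DFunLike.congr_fun hJ _).trans ?_
    exact congrArg (fun u' => mfderiv 𝓘(ℝ, E) 𝓘(ℝ, E) e (j (φ.symm w))
      (mfderiv (𝓡 r) 𝓘(ℝ, E) j (φ.symm w) u')) h5

end Integrable

/-! ### Involutivity, the global form Ω and the twisted Poisson identity -/

section Main

universe u

variable {E : Type*} [NormedAddCommGroup E] [NormedSpace ℝ E] [FiniteDimensional ℝ E]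
  {P : Type u} [TopologicalSpace P] [ChartedSpace E P] [IsManifold 𝓘(ℝ, E) ∞ P]

omit [FiniteDimensional ℝ E] [IsManifold 𝓘(ℝ, E) ∞ P] in
theorem BivectorField.contDiffAt_inChart (π : BivectorField E P) {x₀ : P} {y : E}
    (hy : y ∈ (extChartAt 𝓘(ℝ, E) x₀).target) :
    ContDiffAt ℝ ∞ (bivectorInChart π.toFun x₀) y :=
  (π.smooth' x₀).contDiffAt ((isOpen_extChartAt_target x₀).mem_nhds hy)

/-- An integrable characteristic distribution is involutive. -/
theorem lieBracket_mem_range_of_isIntegrable (π : BivectorField E P)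
    (hint : IsIntegrableDistribution π.charDistribution) (x : P) (α β : E →L[ℝ] ℝ) :
    VectorField.lieBracket ℝ (fun z => bivectorSharp (bivectorInChart π.toFun x z) α)
      (fun z => bivectorSharp (bivectorInChart π.toFun x z) β) (extChartAt 𝓘(ℝ, E) x x) ∈
      (bivectorSharp (bivectorInChart π.toFun x (extChartAt 𝓘(ℝ, E) x x))).toLinearMap.range := by
  obtain ⟨r, O, _, _, _, j, hj, -, ⟨o, rfl⟩, hD⟩ := hint x
  obtain ⟨J, S, z, hz, hJ, hS, hSJ, hT⟩ := exists_parametrization_of_isImmersion hj o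
  have hp := (π.contDiffAt_inChart (mem_extChartAt_target (j o))).differentiableAt
    (by simp : (∞ : WithTop ℕ∞) ≠ 0)
  -- The equality of the two ranges is needed all along the integral manifold near z: it makes the
  -- fields p♯α tangent there, and at z it returns the bracket to the image of p♯.
  have hrange : ∀ᶠ w in 𝓝 z,
      (bivectorSharp (bivectorInChart π.toFun (j o) (J w))).toLinearMap.range =
        (fderiv ℝ J w).toLinearMap.range := by
    filter_upwards [hT] with w ⟨o', hs, hw, hu⟩
    rw [hu, hw, range_bivectorSharp_inChart π ((extChartAt 𝓘(ℝ, E) (j o)).map_source hs)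
      ((extChartAt 𝓘(ℝ, E) (j o)).left_inv hs)]
    exact congrArg (Submodule.map _) (hD o').symm
  have htan : ∀ α : E →L[ℝ] ℝ, ∀ᶠ w in 𝓝 z,
      bivectorSharp (bivectorInChart π.toFun (j o) (J w)) α ∈ (fderiv ℝ J w).toLinearMap.range :=
    fun α => hrange.mono fun w hw => hw ▸ ⟨α, rfl⟩
  have hle : (2 : WithTop ℕ∞) ≤ ∞ := ENat.LEInfty.out
  rw [← hz] at hp ⊢
  rw [hrange.self_of_nhds]
  exact lieBracket_mem_range_of_tangent (hJ.of_le hle) (hS.of_le hle) hSJ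
    (fderiv_bivectorSharp_apply hp α).1 (htan α)
    (fderiv_bivectorSharp_apply hp β).1 (htan β)

variable [T2Space P] [SecondCountableTopology P]

/-- A bivector field of constant rank is inverted by a global smooth 2-form. -/
theorem exists_inverting_form (π : BivectorField E P)
    (hreg : IsRegularDistribution π.charDistribution) :
    ∃ Ω : DiffForm E P 2, ∀ x, π.InvertedAt x (Ω.toFun x) := by
  have : LocallyCompactSpace P := ChartedSpace.locallyCompactSpace E P
  obtain ⟨r, hr⟩ := hreg
  have hloc : ∀ x₀ : P, ∃ (w : E → E [⋀^Fin 2]→L[ℝ] ℝ) (U : Set P), IsOpen U ∧ x₀ ∈ U ∧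
      ∀ x ∈ U, x ∈ (extChartAt 𝓘(ℝ, E) x₀).source ∧
        ContDiffAt ℝ ∞ w (extChartAt 𝓘(ℝ, E) x₀ x) ∧
        InvertsBivector (bivectorInChart π.toFun x₀ (extChartAt 𝓘(ℝ, E) x₀ x))
          (w (extChartAt 𝓘(ℝ, E) x₀ x)) := by
    intro x₀
    have ht := (isOpen_extChartAt_target (I := 𝓘(ℝ, E)) x₀).eventually_mem
      (mem_extChartAt_target x₀)
    obtain ⟨w, hw⟩ := exists_local_form (r := r)
      (ht.mono fun y hy => π.contDiffAt_inChart hy)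
      (ht.mono fun y hy => (finrank_range_bivectorSharp_inChart π hy).trans (hr _))
    have h1 := ((continuousAt_extChartAt (I := 𝓘(ℝ, E)) x₀).eventually hw)
    have h2 := (isOpen_extChartAt_source (I := 𝓘(ℝ, E)) x₀).eventually_mem
      (mem_extChartAt_source x₀)
    obtain ⟨U, hU, hUo, hxU⟩ := eventually_nhds_iff.1 (h2.and h1)
    exact ⟨w, U, hUo, hxU, hU⟩
  choose w U hUo hxU hU using hloc
  obtain ⟨ρ, hρ⟩ := SmoothPartitionOfUnity.exists_isSubordinate 𝓘(ℝ, E) isClosed_univ U hUo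
    (fun x _ => Set.mem_iUnion.2 ⟨x, hxU x⟩)
  let g : P → P → E [⋀^Fin 2]→L[ℝ] ℝ := fun i x =>
    (w i (extChartAt 𝓘(ℝ, E) i x)).compContinuousLinearMap
      (mfderiv 𝓘(ℝ, E) 𝓘(ℝ, E) (extChartAt 𝓘(ℝ, E) i) x)
  let Ω : ∀ x : P, TangentSpace 𝓘(ℝ, E) x [⋀^Fin 2]→L[ℝ] ℝ := fun x =>
    (∑ᶠ i, ρ i x • g i x : E [⋀^Fin 2]→L[ℝ] ℝ)
  have hsmooth : ∀ x₀ : P, ContDiffOn ℝ ∞ (formInChart Ω x₀) (extChartAt 𝓘(ℝ, E) x₀).target := by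
    intro x₀ y hy
    refine ContDiffAt.contDiffWithinAt ?_
    let e := extChartAt 𝓘(ℝ, E) x₀
    -- With x₀ fixed, all chart expressions take values in one vector space, where smoothness of
    -- partition-of-unity sums applies; only indices whose ρ i has the point in its closed support
    -- matter.
    have h1 : ContMDiffAt 𝓘(ℝ, E) 𝓘(ℝ, E [⋀^Fin 2]→L[ℝ] ℝ) ∞
        (fun x => ∑ᶠ i, ρ i x • formInChart (g i) x₀ (e x)) (e.symm y) := by
      refine ρ.contMDiffAt_finsum fun i hi => ?_
      have hs := (hU i _ (hρ i hi))
      have h2 : ContDiffAt ℝ ∞ (formInChart (g i) x₀) y :=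
        contDiffAt_formInChart_pullback hy hs.1 hs.2.1
      have h3 : ContMDiffAt 𝓘(ℝ, E) 𝓘(ℝ, E) ∞ e (e.symm y) :=
        contMDiffAt_extChartAt' (by simpa [e] using e.map_target hy)
      rw [← e.right_inv hy] at h2
      exact h2.contMDiffAt.comp (e.symm y) h3
    have h4 : ContDiffAt ℝ ∞ (fun y => ∑ᶠ i, ρ i (e.symm y) • formInChart (g i) x₀ (e (e.symm y)))
        y := by
      rw [← contMDiffAt_iff_contDiffAt]
      have h3 : ContMDiffAt 𝓘(ℝ, E) 𝓘(ℝ, E) ∞ e.symm y :=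
        (contMDiffOn_extChartAt_symm x₀).contMDiffAt ((isOpen_extChartAt_target x₀).mem_nhds hy)
      exact h1.comp y h3
    refine h4.congr_of_eventuallyEq ?_
    filter_upwards [(isOpen_extChartAt_target x₀).mem_nhds hy] with z hz
    rw [e.right_inv hz]
    refine Eq.trans ?_ (ρ.sum_finsupport_smul_eq_finsum (e.symm z)
      fun i _ => formInChart (g i) x₀ z)
    have h5 : Ω (e.symm z) = ∑ i ∈ ρ.finsupport (e.symm z), ρ i (e.symm z) • g i (e.symm z) :=
      (ρ.sum_finsupport_smul_eq_finsum (e.symm z) g).symm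
    ext v
    rw [ContinuousAlternatingMap.sum_apply]
    let u : Fin 2 → E := fun i =>
      mfderiv 𝓘(ℝ, E) 𝓘(ℝ, E) (extChartAt 𝓘(ℝ, E) x₀).symm z (v i)
    have h6 : Ω (e.symm z) u = _ := congrArg (fun q : E [⋀^Fin 2]→L[ℝ] ℝ => q u) h5
    exact (formInChart_of_eq Ω rfl v).trans (h6.trans (ContinuousAlternatingMap.sum_apply _ _))
  refine ⟨⟨Ω, hsmooth⟩, fun x => ?_⟩
  -- The inversion condition at x is affine in the 2-form, so its solutions form a convex set.
  refine ρ.finsum_smul_mem_convex (g := g) (t := {v | π.InvertedAt x v}) (Set.mem_univ x) ?_ ?_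
  · intro i hi
    have hs := hU i x (hρ i (subset_tsupport _ hi))
    exact invertedAt_of_inChart π hs.1 hs.2.2
  · intro v hv v' hv' a b _ _ hab α β
    refine (congrArg₂ (fun s t => a * s + b * t) (hv α β) (hv' α β)).trans ?_
    exact (add_mul a b _).symm.trans (by rw [hab, one_mul])

omit [T2Space P] [SecondCountableTopology P] in
/-- If the characteristic distribution is integrable, the exterior derivative of a 2-form that
inverts `π` twists the Poisson identity for `π`. -/
theorem isTwistedPoisson_d (π : BivectorField E P)
    (hint : IsIntegrableDistribution π.charDistribution) (Ω : DiffForm E P 2)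
    (hΩ : ∀ x, π.InvertedAt x (Ω.toFun x)) : π.IsTwistedPoisson Ω.d := by
  refine ⟨Ω.d_isClosed, fun x => ?_⟩
  have ht := mem_extChartAt_target (I := 𝓘(ℝ, E)) x
  have hx : (extChartAt 𝓘(ℝ, E) x).symm (extChartAt 𝓘(ℝ, E) x x) = x := extChartAt_to_inv x
  have key := half_flatSchouten_eq (p := bivectorInChart π.toFun x) (w := formInChart Ω.toFun x)
    ((π.contDiffAt_inChart ht).differentiableAt (by simp))
    ((Ω.contDiffAt_formInChart ht).differentiableAt (by simp))
    (((isOpen_extChartAt_target x).eventually_mem ht).mono fun y hy =>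
      invertsBivector_inChart π Ω.toFun hy (hΩ _))
    (lieBracket_mem_range_of_isIntegrable π hint x)
  refine ContinuousAlternatingMap.ext fun v => ?_
  -- The covectors at x are moved to E by the differential of the inverse chart, exactly as in the
  -- definition of the Schouten bracket at x.
  have h1 := DFunLike.congr_fun key fun i => (v i : E →L[ℝ] ℝ).comp
    (mfderiv 𝓘(ℝ, E) 𝓘(ℝ, E) (extChartAt 𝓘(ℝ, E) x).symm (extChartAt 𝓘(ℝ, E) x x) : E →L[ℝ] E)
  refine Eq.trans h1 ?_
  refine congrArg (extDeriv (formInChart Ω.toFun x) (extChartAt 𝓘(ℝ, E) x x)) (funext fun i => ?_)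
  exact bivectorSharp_inChart_comp_symm π ht hx (v i)

end Main

theorem mainTheorem2 {E : Type*} [NormedAddCommGroup E] [NormedSpace ℝ E] [FiniteDimensional ℝ E]
    {P : Type*} [TopologicalSpace P] [T2Space P] [SecondCountableTopology P]
    [ChartedSpace E P] [IsManifold 𝓘(ℝ, E) ∞ P]
    (π : BivectorField E P)
    (hreg : IsRegularDistribution π.charDistribution)
    (hint : IsIntegrableDistribution π.charDistribution) :
    ∃ φ : DiffForm E P 3, φ.IsExact ∧ π.IsTwistedPoisson φ := by
  obtain ⟨Ω, hΩ⟩ := exists_inverting_form π hreg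
  exact ⟨Ω.d, Ω.d_isExact, isTwistedPoisson_d π hint Ω hΩ⟩
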